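/- Let $\mathbb D=\{z\in\mathbb C:|z|<1\}$, let $\mathcal S$ be the class of injective analytic functions $f$ on $\mathbb D$ with $f(0)=0$ and $f'(0)=1$, and write $f(z)=z+\sum_{n=2}^\infty a_nz^n$. Let $k=\sqrt2+1$ and $$\phi_0(z)=1+\frac zk\cdot\frac{k+z}{k-z}\qquad(z\in\mathbb D).$$ Let $\mathcal S^*_R=\mathcal S^*(\phi_0)$ be the class of all $f\in\mathcal S$ such that $zf'(z)/f(z)\prec\phi_0(z)$, that is, such that there is an analytic function $\omega:\mathbb D\to\mathbb D$ with $\omega(0)=0$ and $zf'(z)/f(z)=\phi_0(\omega(z))$ for all $z\in\mathbb D$ (the left-hand side being $1$ at $z=0$). Then for every $f\in\mathcal S^*_R$ and every $z$ with $|z|\le 1/3$, the series below converges and the Bohr inequality $$|z|+\sum_{n=2}^\infty|a_n|\,|z|^n\le d\bigl(f(0),\partial f(\mathbb D)\bigr)$$ holds, where $d$ is the Euclidean distance. Moreover, there is a function $h\in\mathcal S$ with $zh'(z)/h(z)=\phi_0(z)$ on $\mathbb D$, and for every such $h$ the limit $h(-1):=\lim_{r\to1^-}h(-r)$ exists, the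 equation $h(r)+h(-1)=0$ has a smallest root $r_f$ in $(0,1)$, and $r_f>1/3$. -/

import Mathlib

namespace Bohr

/-- The open unit disk of the complex plane. -/
def unitDisk : Set ℂ := Metric.ball 0 1

/-- The class `S` of univalent analytic functions on the unit disk, normalized by
`f 0 = 0` and `f' 0 = 1`. Only the values on the disk matter. -/
structure IsNormalizedUnivalent (f : ℂ → ℂ) : Prop where
  analytic : DifferentiableOn ℂ f unitDisk
  injective : Set.InjOn f unitDisk
  map_zero : f 0 = 0
  deriv_zero : deriv f 0 = 1

/-- `Subordinate p q`: there is an analytic `ω` from the disk to the disk with `ω 0 = 0` and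
`p z = q (ω z)` on the disk. -/
def Subordinate (p q : ℂ → ℂ) : Prop :=
  ∃ ω : ℂ → ℂ, DifferentiableOn ℂ ω unitDisk ∧ Set.MapsTo ω unitDisk unitDisk ∧ ω 0 = 0 ∧
    ∀ z ∈ unitDisk, p z = q (ω z)

/-- The function `z f'(z) / f(z)`, with its removable singularity at `0` filled in by the
value `1` (the limit there when `f 0 = 0` and `f' 0 = 1`). -/
noncomputable def starQuotient (f : ℂ → ℂ) (z : ℂ) : ℂ :=
  if z = 0 then 1 else z * deriv f z / f z

/-- The Ma-Minda starlike class `S*(φ)`. -/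
def starlikeClass (φ : ℂ → ℂ) : Set (ℂ → ℂ) :=
  {f | IsNormalizedUnivalent f ∧ Subordinate (starQuotient f) φ}

/-- `h` is the function in `S` with `z h'(z) / h(z) = φ(z)` on the disk. -/
def IsKoebeOf (φ h : ℂ → ℂ) : Prop :=
  IsNormalizedUnivalent h ∧ ∀ z ∈ unitDisk, starQuotient h z = φ z

/-- The rational function `1 + (z / k) ((k + z) / (k - z))` with `k = √2 + 1`. -/
noncomputable def phiR (z : ℂ) : ℂ :=
  1 + z / ((Real.sqrt 2 + 1 : ℝ) : ℂ) *
    ((((Real.sqrt 2 + 1 : ℝ) : ℂ) + z) / (((Real.sqrt 2 + 1 : ℝ) : ℂ) - z))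

/-- The class `S*_R`. -/
noncomputable def starlikeClassR : Set (ℂ → ℂ) := starlikeClass phiR

/-- The `n`-th Taylor coefficient of `f` at `0`. -/
noncomputable def taylorCoeff (f : ℂ → ℂ) (n : ℕ) : ℂ :=
  iteratedDeriv n f 0 / (n.factorial : ℂ)

/-- The Bohr inequality `r + ∑_{n ≥ 2} |a_n| r ^ n ≤ d(f(0), ∂ f(𝔻))`, together with the
convergence of its left-hand side. -/
def BohrInequality (f : ℂ → ℂ) (r : ℝ) : Prop :=
  Summable (fun n : ℕ => ‖taylorCoeff f (n + 2)‖ * r ^ (n + 2)) ∧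
    r + ∑' n : ℕ, ‖taylorCoeff f (n + 2)‖ * r ^ (n + 2) ≤
      Metric.infDist (f 0) (frontier (f '' unitDisk))

/-- `rf` is the smallest root in `(0, 1)` of `h(r) + h(-1) = 0`, where `h(-1)` is
the limit of `h(-r)` as `r` increases to `1`, which is required to exist. -/
def IsSmallestRoot (h : ℂ → ℂ) (rf : ℝ) : Prop :=
  ∃ L : ℂ, Filter.Tendsto (fun r : ℝ => h (-(r : ℂ))) (nhdsWithin 1 (Set.Iio 1)) (nhds L) ∧
    IsLeast {r : ℝ | 0 < r ∧ r < 1 ∧ h (r : ℂ) + L = 0} rf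

end Bohr

/-!
The function `φ₀` maps the disk into the half-plane `re w > 1 / 2`, so `S*_R` consists of functions
starlike of order `1 / 2`, and for the latter `1 / 3` is already a Bohr radius. Indeed, let
`P = z f' / f`, so that `re P > 1 / 2` and `P 0 = 1`. Carathéodory's inequality bounds the Taylor
coefficients of `P` by `1`, and the recurrence coming from `z f' = P f` passes the bound on to
those of `f`. Schwarz's lemma for `(P - 1) / P` gives `re P ≥ 1 / (1 + |z|)`; integrated along
radii, this becomes `|f z| ≥ |z| / (1 + |z|)`, so the boundary of the image stays at distance at
least `1 / 2` from `0`. Since `r + r ^ 2 + ⋯ = r / (1 - r) ≤ 1 / 2` exactly for `r ≤ 1 / 3`, the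
Bohr inequality follows.

With `s = √2 - 1`, the solution of `z h' / h = φ₀` is `h z = z / (exp (s z) (1 - s z) ^ 2)`. It is
univalent because the second derivative of the denominator is less than `1` on the disk, and the
location of the root comes from `1 / 2 < -h (-1) < h 1` and `h r < 1 / 2` for `r ≤ 1 / 3`.
-/

open Complex Filter Metric Real Set Topology

namespace Bohr

/-! ### Carathéodory's inequality -/

section Circle

variable {P : ℂ → ℂ} {R : ℝ}

lemma norm_circleAverage_le {E : Type*} [NormedAddCommGroup E] [NormedSpace ℝ E] (f : ℂ → E)
    (c : ℂ) (R : ℝ) : ‖circleAverage f c R‖ ≤ circleAverage (fun z => ‖f z‖) c R := by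
  rw [circleAverage, circleAverage, norm_smul, Real.norm_of_nonneg (by positivity), smul_eq_mul]
  gcongr
  exact intervalIntegral.norm_integral_le_integral_norm two_pi_pos.le

lemma taylorCoeff_eq_circleAverage (hP : DiffContOnCl ℂ P (ball 0 R)) (hR : 0 < R) (n : ℕ) :
    taylorCoeff P n = circleAverage (fun z => (z ^ n)⁻¹ * P z) 0 R := by
  have cauchy := hP.circleIntegral_one_div_sub_center_pow_smul hR n
  have integrand : ∀ z : ℂ, (z - 0)⁻¹ • ((z ^ n)⁻¹ * P z) = (1 / (z - 0) ^ (n + 1)) • P z := by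
    intro z
    simp only [sub_zero, smul_eq_mul, one_div, pow_succ, mul_inv]
    ring
  rw [circleAverage_eq_circleIntegral hR.ne']
  simp only [integrand]
  rw [cauchy, smul_smul, smul_eq_mul, taylorCoeff]
  have : (2 * π * I : ℂ) ≠ 0 := two_pi_I_ne_zero
  field_simp

-- The conjugate of the mean value property for `z ^ n * P z` shows that the antiholomorphic part
-- of `2 * re P` does not contribute.
lemma circleAverage_inv_pow_mul_conj_eq_zero (hP : DiffContOnCl ℂ P (ball 0 R)) (hR : 0 < R)
    {n : ℕ} (hn : n ≠ 0) :
    circleAverage (fun z => (z ^ n)⁻¹ * (starRingEnd ℂ) (P z)) 0 R = 0 := by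
  set F : ℂ → ℂ := fun z => z ^ n * P z
  have hF : DiffContOnCl ℂ F (ball 0 |R|) := by
    rw [abs_of_pos hR]
    exact ((differentiable_id.pow n).diffContOnCl).smul hP
  have hFint : CircleIntegrable F 0 R :=
    (hF.continuousOn_ball.mono sphere_subset_closedBall).circleIntegrable'
  have hconj : EqOn (fun z => (z ^ n)⁻¹ * (starRingEnd ℂ) (P z))
      (((R ^ 2) ^ n)⁻¹ • (conjCLE.toContinuousLinearMap ∘ F)) (sphere 0 |R|) := by
    intro z hz
    have hz' : normSq z = R ^ 2 := by
      rw [normSq_eq_norm_sq, mem_sphere_zero_iff_norm.1 hz, sq_abs]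
    simp only [F, ← inv_pow, inv_def z, hz', ofReal_pow, ofReal_inv, mul_pow,
      ContinuousLinearEquiv.coe_coe, ContinuousAlgEquiv.coe_coeCLE, Pi.smul_apply,
      Function.comp_apply, conjCAE_apply, map_mul, map_pow, real_smul]
    ring
  rw [circleAverage_congr_sphere hconj, circleAverage_smul,
    ContinuousLinearMap.circleAverage_comp_comm _ hFint, hF.circleAverage]
  simp [F, hn]

lemma taylorCoeff_eq_circleAverage_re (hP : DiffContOnCl ℂ P (ball 0 R)) (hR : 0 < R)
    (a : ℝ) {n : ℕ} (hn : n ≠ 0) :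
    taylorCoeff P n = circleAverage (fun z => (z ^ n)⁻¹ * (2 * ((P z).re - a) : ℝ)) 0 R := by
  have hPc : ContinuousOn P (sphere 0 R) :=
    hP.continuousOn_ball.mono sphere_subset_closedBall
  have hpow : ContinuousOn (fun z : ℂ => (z ^ n)⁻¹) (sphere 0 R) :=
    (continuousOn_id.pow n).inv₀ fun z hz => pow_ne_zero n (ne_of_mem_sphere hz hR.ne')
  have hint : CircleIntegrable (fun z => (z ^ n)⁻¹ * P z) 0 R :=
    (hpow.mul hPc).circleIntegrable hR.le
  have hint' : CircleIntegrable (fun z => (z ^ n)⁻¹ * (starRingEnd ℂ) (P z - 2 * a)) 0 R :=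
    (hpow.mul (continuous_conj.comp_continuousOn (hPc.sub continuousOn_const))).circleIntegrable
      hR.le
  have hsum := circleAverage_fun_add hint hint'
  rw [circleAverage_inv_pow_mul_conj_eq_zero (hP.sub_const (2 * (a : ℂ))) hR hn, add_zero,
    ← taylorCoeff_eq_circleAverage hP hR] at hsum
  rw [← hsum]
  congr 1
  funext z
  have : P z + (starRingEnd ℂ) (P z) = 2 * (P z).re := by rw [add_conj]; push_cast; ring
  simp only [map_sub, map_mul, map_ofNat, conj_ofReal]
  push_cast
  linear_combination (z ^ n)⁻¹ * this

lemma norm_taylorCoeff_mul_pow_le (hP : DiffContOnCl ℂ P (ball 0 R)) (hR : 0 < R) {a : ℝ}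
    (ha : ∀ z ∈ sphere 0 R, a ≤ (P z).re) {n : ℕ} (hn : n ≠ 0) :
    ‖taylorCoeff P n‖ * R ^ n ≤ 2 * ((P 0).re - a) := by
  have hnorm : EqOn (fun z => ‖(z ^ n)⁻¹ * (2 * ((P z).re - a) : ℝ)‖)
      (fun z => ((R ^ n)⁻¹ * 2) • (reCLM ∘ fun z => P z - a) z) (sphere 0 |R|) := by
    intro z hz
    rw [abs_of_pos hR] at hz
    have : 0 ≤ 2 * ((P z).re - a) := by linarith [ha z hz]
    simp only [norm_mul, norm_inv, norm_pow, mem_sphere_zero_iff_norm.1 hz, norm_real,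
      Real.norm_of_nonneg this]
    simp [mul_assoc]
  have hPa : DiffContOnCl ℂ (fun z => P z - a) (ball 0 |R|) := by
    rw [abs_of_pos hR]
    exact hP.sub_const (a : ℂ)
  have hint : CircleIntegrable (fun z => P z - a) 0 R :=
    (hPa.continuousOn_ball.mono sphere_subset_closedBall).circleIntegrable'
  have h := norm_circleAverage_le (fun z => (z ^ n)⁻¹ * (2 * ((P z).re - a) : ℝ)) 0 R
  rw [← taylorCoeff_eq_circleAverage_re hP hR a hn, circleAverage_congr_sphere hnorm,
    circleAverage_fun_smul, ContinuousLinearMap.circleAverage_comp_comm _ hint,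
    hPa.circleAverage] at h
  calc ‖taylorCoeff P n‖ * R ^ n ≤ ((R ^ n)⁻¹ * 2) • reCLM (P 0 - a) * R ^ n := by gcongr
    _ = 2 * ((P 0).re - a) := by
      have := pow_ne_zero n hR.ne'
      simp only [reCLM_apply, sub_re, ofReal_re, smul_eq_mul]
      field_simp

end Circle

lemma norm_taylorCoeff_le_of_le_re {P : ℂ → ℂ} (hP : DifferentiableOn ℂ P unitDisk) {a : ℝ}
    (ha : ∀ z ∈ unitDisk, a ≤ (P z).re) {n : ℕ} (hn : n ≠ 0) :
    ‖taylorCoeff P n‖ ≤ 2 * ((P 0).re - a) := by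
  have hlim : Tendsto (fun R : ℝ => ‖taylorCoeff P n‖ * R ^ n) (𝓝[<] 1)
      (𝓝 (‖taylorCoeff P n‖ * 1 ^ n)) :=
    (Continuous.tendsto (by fun_prop) 1).mono_left nhdsWithin_le_nhds
  rw [one_pow, mul_one] at hlim
  refine le_of_tendsto hlim ?_
  filter_upwards [Ioo_mem_nhdsLT one_pos] with R hR
  have hsub : closedBall (0 : ℂ) R ⊆ unitDisk := closedBall_subset_ball hR.2
  exact norm_taylorCoeff_mul_pow_le (hP.diffContOnCl_ball hsub) hR.1
    (fun z hz => ha z (hsub (sphere_subset_closedBall hz))) hn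

/-! ### Taylor coefficients -/

lemma mem_unitDisk {z : ℂ} : z ∈ unitDisk ↔ ‖z‖ < 1 := mem_ball_zero_iff

lemma isOpen_unitDisk : IsOpen unitDisk := isOpen_ball

lemma zero_mem_unitDisk : (0 : ℂ) ∈ unitDisk := mem_ball_self one_pos

lemma real_mul_mem_unitDisk {t : ℝ} (ht : t ∈ Icc (0 : ℝ) 1) {z : ℂ} (hz : z ∈ unitDisk) :
    (t : ℂ) * z ∈ unitDisk := by
  rw [mem_unitDisk, norm_mul, norm_real, Real.norm_of_nonneg ht.1]
  exact (mul_le_of_le_one_left (norm_nonneg z) ht.2).trans_lt (mem_unitDisk.1 hz)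

lemma analyticAt_zero {f : ℂ → ℂ} (hf : DifferentiableOn ℂ f unitDisk) : AnalyticAt ℂ f 0 :=
  hf.analyticAt (isOpen_unitDisk.mem_nhds zero_mem_unitDisk)

lemma hasSum_taylorCoeff {f : ℂ → ℂ} (hf : DifferentiableOn ℂ f unitDisk) {z : ℂ}
    (hz : z ∈ unitDisk) : HasSum (fun n => taylorCoeff f n * z ^ n) (f z) := by
  refine (hasSum_taylorSeries_on_ball hf hz).congr_fun fun n => ?_
  rw [taylorCoeff, sub_zero, smul_eq_mul, smul_eq_mul]
  ring

lemma taylorCoeff_mul {f g : ℂ → ℂ} (hf : AnalyticAt ℂ f 0) (hg : AnalyticAt ℂ g 0) (n : ℕ) :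
    taylorCoeff (f * g) n =
      ∑ i ∈ Finset.range (n + 1), taylorCoeff f i * taylorCoeff g (n - i) := by
  rw [taylorCoeff, iteratedDeriv_mul hf.contDiffAt hg.contDiffAt, Finset.sum_div]
  refine Finset.sum_congr rfl fun i hi => ?_
  have hle : i ≤ n := Nat.lt_succ_iff.1 (Finset.mem_range.1 hi)
  rw [Nat.cast_choose ℂ hle, taylorCoeff, taylorCoeff]
  have := n.factorial_ne_zero
  field_simp

lemma taylorCoeff_id (n : ℕ) : taylorCoeff id n = if n = 1 then 1 else 0 := by
  rw [taylorCoeff, iteratedDeriv_id]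
  split_ifs <;> simp_all

lemma taylorCoeff_deriv (f : ℂ → ℂ) (n : ℕ) :
    taylorCoeff (deriv f) n = (n + 1) * taylorCoeff f (n + 1) := by
  have : (n : ℂ) + 1 ≠ 0 := n.cast_add_one_ne_zero
  rw [taylorCoeff, taylorCoeff, ← iteratedDeriv_succ', Nat.factorial_succ]
  push_cast
  field_simp

lemma taylorCoeff_id_mul_deriv {f : ℂ → ℂ} (hf : AnalyticAt ℂ f 0) (n : ℕ) :
    taylorCoeff (id * deriv f) n = n * taylorCoeff f n := by
  rw [taylorCoeff_mul analyticAt_id hf.deriv]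
  simp only [taylorCoeff_id, ite_mul, one_mul, zero_mul, Finset.sum_ite_eq', Finset.mem_range]
  cases n with
  | zero => simp
  | succ n => simp [taylorCoeff_deriv]

lemma taylorCoeff_congr {f g : ℂ → ℂ} (h : EqOn f g unitDisk) (n : ℕ) :
    taylorCoeff f n = taylorCoeff g n := by
  rw [taylorCoeff, taylorCoeff,
    (h.eventuallyEq_of_mem (isOpen_unitDisk.mem_nhds zero_mem_unitDisk)).iteratedDeriv_eq]

namespace IsNormalizedUnivalent

variable {f : ℂ → ℂ}

lemma eq_mul_dslope (hf : IsNormalizedUnivalent f) (z : ℂ) : f z = z * dslope f 0 z := by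
  simpa [hf.map_zero] using (sub_smul_dslope f 0 z).symm

lemma differentiableOn_dslope (hf : IsNormalizedUnivalent f) :
    DifferentiableOn ℂ (dslope f 0) unitDisk :=
  (Complex.differentiableOn_dslope (isOpen_unitDisk.mem_nhds zero_mem_unitDisk)).2 hf.analytic

lemma dslope_ne_zero (hf : IsNormalizedUnivalent f) {z : ℂ} (hz : z ∈ unitDisk) :
    dslope f 0 z ≠ 0 := by
  rcases eq_or_ne z 0 with rfl | h0
  · simp [hf.deriv_zero]
  · intro h
    refine h0 (hf.injective hz zero_mem_unitDisk ?_)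
    rw [hf.map_zero, hf.eq_mul_dslope, h, mul_zero]

lemma starQuotient_eq (hf : IsNormalizedUnivalent f) {z : ℂ} (hz : z ∈ unitDisk) :
    starQuotient f z = deriv f z / dslope f 0 z := by
  rcases eq_or_ne z 0 with rfl | h0
  · simp [starQuotient, hf.deriv_zero]
  · rw [starQuotient, if_neg h0, hf.eq_mul_dslope, mul_div_mul_left _ _ h0]

lemma differentiableOn_starQuotient (hf : IsNormalizedUnivalent f) :
    DifferentiableOn ℂ (starQuotient f) unitDisk :=
  ((hf.analytic.deriv isOpen_unitDisk).div hf.differentiableOn_dslope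
    fun _ => hf.dslope_ne_zero).congr fun _ => hf.starQuotient_eq

lemma mul_deriv (hf : IsNormalizedUnivalent f) {z : ℂ} (hz : z ∈ unitDisk) :
    z * deriv f z = f z * starQuotient f z := by
  have := hf.dslope_ne_zero hz
  rw [hf.starQuotient_eq hz, hf.eq_mul_dslope z]
  field_simp

lemma mul_deriv_dslope (hf : IsNormalizedUnivalent f) {z : ℂ} (hz : z ∈ unitDisk) :
    z * deriv (dslope f 0) z = dslope f 0 z * (starQuotient f z - 1) := by
  have hne := hf.dslope_ne_zero hz
  have hdslope := (hf.differentiableOn_dslope.differentiableAt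
    (isOpen_unitDisk.mem_nhds hz)).hasDerivAt
  have hderiv : deriv f z = dslope f 0 z + z * deriv (dslope f 0) z := by
    conv_lhs => rw [show f = id * dslope f 0 from funext hf.eq_mul_dslope]
    simpa using ((hasDerivAt_id z).mul hdslope).deriv
  rw [hf.starQuotient_eq hz, hderiv]
  field_simp
  ring

lemma taylorCoeff_recurrence (hf : IsNormalizedUnivalent f) (n : ℕ) :
    (n + 1) * taylorCoeff f (n + 2) = ∑ i ∈ Finset.range (n + 1),
      taylorCoeff f (i + 1) * taylorCoeff (starQuotient f) (n + 1 - i) := by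
  have hf0 : taylorCoeff f 0 = 0 := by simp [taylorCoeff, hf.map_zero]
  have hq0 : taylorCoeff (starQuotient f) 0 = 1 := by simp [taylorCoeff, starQuotient]
  have hprod : taylorCoeff (id * deriv f) (n + 2) = taylorCoeff (f * starQuotient f) (n + 2) :=
    taylorCoeff_congr (fun z hz => hf.mul_deriv hz) _
  rw [taylorCoeff_id_mul_deriv (analyticAt_zero hf.analytic),
    taylorCoeff_mul (analyticAt_zero hf.analytic)
      (analyticAt_zero hf.differentiableOn_starQuotient),
    Finset.sum_range_succ, Nat.sub_self, hq0, Finset.sum_range_succ', hf0] at hprod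
  simp only [Nat.reduceSubDiff] at hprod
  push_cast at hprod
  linear_combination hprod

lemma taylorCoeff_one (hf : IsNormalizedUnivalent f) : taylorCoeff f 1 = 1 := by
  simp [taylorCoeff, hf.deriv_zero]

lemma eqOn_of_starQuotient_eqOn (hf : IsNormalizedUnivalent f) {g : ℂ → ℂ}
    (hg : IsNormalizedUnivalent g)
    (h : EqOn (starQuotient f) (starQuotient g) unitDisk) : EqOn f g unitDisk := by
  have hcoeff : ∀ n, taylorCoeff f n = taylorCoeff g n := by
    intro n
    induction n using Nat.strong_induction_on with
    | _ n ih =>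
      match n with
      | 0 => simp [taylorCoeff, hf.map_zero, hg.map_zero]
      | 1 => rw [hf.taylorCoeff_one, hg.taylorCoeff_one]
      | m + 2 =>
        refine mul_left_cancel₀ (m.cast_add_one_ne_zero (R := ℂ)) ?_
        rw [hf.taylorCoeff_recurrence, hg.taylorCoeff_recurrence]
        refine Finset.sum_congr rfl fun i hi => ?_
        have := Finset.mem_range.1 hi
        rw [ih (i + 1) (by lia), taylorCoeff_congr h]
  intro z hz
  refine (hasSum_taylorCoeff hf.analytic hz).unique ?_
  simpa only [hcoeff] using hasSum_taylorCoeff hg.analytic hz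

end IsNormalizedUnivalent

/-- Robertson's class of functions starlike of order `α`: the members of `S` with
`re (z f'(z) / f(z)) > α` on the disk. -/
def starlikeOfOrder (α : ℝ) : Set (ℂ → ℂ) :=
  {f | IsNormalizedUnivalent f ∧ ∀ z ∈ unitDisk, α < (starQuotient f z).re}

lemma norm_taylorCoeff_le_one {f : ℂ → ℂ} (hf : f ∈ starlikeOfOrder (1 / 2)) (n : ℕ) :
    ‖taylorCoeff f n‖ ≤ 1 := by
  obtain ⟨hu, hre⟩ := hf
  have hquot : ∀ k ≠ 0, ‖taylorCoeff (starQuotient f) k‖ ≤ 1 := by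
    intro k hk
    exact (norm_taylorCoeff_le_of_le_re hu.differentiableOn_starQuotient
      (fun z hz => (hre z hz).le) hk).trans_eq (by norm_num [starQuotient])
  induction n using Nat.strong_induction_on with
  | _ n ih =>
    match n with
    | 0 => simp [taylorCoeff, hu.map_zero]
    | 1 => simp [hu.taylorCoeff_one]
    | m + 2 =>
      have hm : ‖(m : ℂ) + 1‖ = m + 1 := by
        rw [← Nat.cast_add_one, Complex.norm_natCast, Nat.cast_add_one]
      have hsum : (m + 1) * ‖taylorCoeff f (m + 2)‖ ≤ (m + 1 : ℝ) := by
        rw [← hm, ← norm_mul, hu.taylorCoeff_recurrence, hm]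
        calc _ ≤ ∑ _i ∈ Finset.range (m + 1), (1 : ℝ) := norm_sum_le_of_le _ fun i hi => by
              have := Finset.mem_range.1 hi
              rw [norm_mul]
              exact mul_le_one₀ (ih _ (by lia)) (norm_nonneg _) (hquot _ (by lia))
          _ = m + 1 := by simp
      exact le_of_mul_le_mul_left (hsum.trans_eq (mul_one _).symm) (by positivity)

/-! ### Growth and covering for starlike functions of order `1 / 2` -/

lemma norm_sub_one_sq (w : ℂ) : ‖w - 1‖ ^ 2 = ‖w‖ ^ 2 - (2 * w.re - 1) := by
  rw [← normSq_eq_norm_sq, ← normSq_eq_norm_sq, normSq_apply, normSq_apply, sub_re, sub_im,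
    one_re, one_im]
  ring

lemma norm_sub_one_le_of_half_lt_re {P : ℂ → ℂ} (hP : DifferentiableOn ℂ P unitDisk)
    (hP0 : P 0 = 1) (hre : ∀ z ∈ unitDisk, 1 / 2 < (P z).re) {z : ℂ} (hz : z ∈ unitDisk) :
    ‖P z - 1‖ ≤ ‖z‖ * ‖P z‖ := by
  have hne : ∀ w ∈ unitDisk, P w ≠ 0 := fun w hw h => by
    have := hre w hw
    norm_num [h] at this
  have hmaps : MapsTo (fun w => (P w - 1) / P w) (ball 0 1) (closedBall 0 1) := fun w hw => by
    rw [mem_closedBall_zero_iff, norm_div, div_le_one (norm_pos_iff.2 (hne w hw)),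
      ← sq_le_sq₀ (norm_nonneg _) (norm_nonneg _)]
    linarith [norm_sub_one_sq (P w), hre w hw]
  have hschwarz : ‖(P z - 1) / P z‖ ≤ ‖z‖ :=
    norm_le_norm_of_mapsTo_ball ((hP.sub_const 1).div hP hne) hmaps (by simp [hP0])
      (mem_unitDisk.1 hz)
  rwa [norm_div, div_le_iff₀ (norm_pos_iff.2 (hne z hz))] at hschwarz

lemma inv_one_add_norm_le_re {P : ℂ → ℂ} (hP : DifferentiableOn ℂ P unitDisk) (hP0 : P 0 = 1)
    (hre : ∀ z ∈ unitDisk, 1 / 2 < (P z).re) {z : ℂ} (hz : z ∈ unitDisk) :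
    (1 + ‖z‖)⁻¹ ≤ (P z).re := by
  have hz1 : 0 ≤ 1 - ‖z‖ ^ 2 := by nlinarith [norm_nonneg z, mem_unitDisk.1 hz]
  have hfactor : ((1 + ‖z‖) * (P z).re - 1) * ((1 - ‖z‖) * (P z).re - 1) ≤ 0 := by
    have hdisk := pow_le_pow_left₀ (norm_nonneg _) (norm_sub_one_le_of_half_lt_re hP hP0 hre hz) 2
    rw [norm_sub_one_sq, mul_pow] at hdisk
    have hre_sq : (P z).re ^ 2 ≤ ‖P z‖ ^ 2 := by
      rw [← sq_abs]
      gcongr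
      exact abs_re_le_norm _
    linarith [mul_le_mul_of_nonneg_left hre_sq hz1]
  rw [inv_le_iff_one_le_mul₀' (by positivity)]
  by_contra! hlt
  have : 0 ≤ ‖z‖ * (P z).re := mul_nonneg (norm_nonneg z) (by linarith [hre z hz])
  exact hfactor.not_gt (mul_pos_of_neg_of_neg (by linarith) (by linarith))

section OrderHalf

variable {f : ℂ → ℂ}

lemma hasDerivAt_comp_ofReal_mul {g : ℂ → ℂ} {z : ℂ} {t : ℝ}
    (hg : DifferentiableAt ℂ g (t * z)) :
    HasDerivAt (fun t : ℝ => g (t * z)) (deriv g (t * z) * z) t := by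
  have hlin : HasDerivAt (fun w : ℂ => w * z) z (t : ℂ) := by
    simpa using (hasDerivAt_id (t : ℂ)).mul_const z
  exact (hg.hasDerivAt.comp (t : ℂ) hlin).comp_ofReal

lemma inner_self_mul (w p : ℂ) : inner ℝ w (w * p) = ‖w‖ ^ 2 * p.re := by
  rw [Complex.inner, mul_right_comm, mul_conj, re_ofReal_mul, normSq_eq_norm_sq]

lemma IsNormalizedUnivalent.inner_dslope (hf : IsNormalizedUnivalent f) {z : ℂ}
    (hz : z ∈ unitDisk) : inner ℝ (dslope f 0 z) (z * deriv (dslope f 0) z) =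
      ‖dslope f 0 z‖ ^ 2 * ((starQuotient f z).re - 1) := by
  rw [hf.mul_deriv_dslope hz, inner_self_mul, sub_re, one_re]

lemma monotoneOn_norm_dslope_mul (hf : f ∈ starlikeOfOrder (1 / 2)) {z : ℂ}
    (hz : z ∈ unitDisk) :
    MonotoneOn (fun t : ℝ => ‖dslope f 0 (t * z)‖ ^ 2 * (1 + t * ‖z‖) ^ 2) (Icc 0 1) := by
  obtain ⟨hu, hre⟩ := hf
  set g := dslope f 0
  have hderiv : ∀ t ∈ Icc (0 : ℝ) 1,
      HasDerivAt (fun t : ℝ => ‖g (t * z)‖ ^ 2 * (1 + t * ‖z‖) ^ 2)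
        (2 * inner ℝ (g (t * z)) (deriv g (t * z) * z) * (1 + t * ‖z‖) ^ 2 +
          ‖g (t * z)‖ ^ 2 * (2 * (1 + t * ‖z‖) * ‖z‖)) t := by
    intro t ht
    have hgt := hasDerivAt_comp_ofReal_mul (hu.differentiableOn_dslope.differentiableAt
      (isOpen_unitDisk.mem_nhds (real_mul_mem_unitDisk ht hz)))
    have hlin : HasDerivAt (fun t : ℝ => 1 + t * ‖z‖) ‖z‖ t := by
      simpa using ((hasDerivAt_id t).mul_const ‖z‖).const_add 1
    exact (hgt.norm_sq.mul (hlin.pow 2)).congr_deriv (by norm_num [g])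
  refine monotoneOn_of_deriv_nonneg (convex_Icc 0 1)
    (fun t ht => (hderiv t ht).continuousAt.continuousWithinAt)
    (fun t ht => (hderiv t (interior_subset ht)).differentiableAt.differentiableWithinAt) ?_
  intro t ht
  have htm := interior_subset ht
  have hmem := real_mul_mem_unitDisk htm hz
  rw [interior_Icc] at ht
  have hradial : t * inner ℝ (g (t * z)) (deriv g (t * z) * z) =
      ‖g (t * z)‖ ^ 2 * ((starQuotient f (t * z)).re - 1) := by
    rw [← hu.inner_dslope hmem, ← real_inner_smul_right, real_smul, mul_right_comm, mul_assoc]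
  have hbound := inv_one_add_norm_le_re hu.differentiableOn_starQuotient (by simp [starQuotient])
    hre hmem
  rw [norm_mul, norm_real, Real.norm_of_nonneg ht.1.le,
    inv_le_iff_one_le_mul₀' (by have := ht.1; positivity)] at hbound
  rw [(hderiv t htm).deriv]
  refine nonneg_of_mul_nonneg_right (a := t) ?_ ht.1
  have := ht.1
  calc 0 ≤ 2 * (1 + t * ‖z‖) * ‖g (t * z)‖ ^ 2 *
        ((1 + t * ‖z‖) * (starQuotient f (t * z)).re - 1) := by
        have := sub_nonneg.2 hbound
        positivity
    _ = _ := by linear_combination -2 * (1 + t * ‖z‖) ^ 2 * hradial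

lemma div_one_add_norm_le_norm (hf : f ∈ starlikeOfOrder (1 / 2)) {z : ℂ} (hz : z ∈ unitDisk) :
    ‖z‖ / (1 + ‖z‖) ≤ ‖f z‖ := by
  have hmono := monotoneOn_norm_dslope_mul hf hz (left_mem_Icc.2 zero_le_one)
    (right_mem_Icc.2 zero_le_one) zero_le_one
  simp only [ofReal_zero, zero_mul, dslope_same, hf.1.deriv_zero, norm_one, add_zero, one_pow,
    mul_one, ofReal_one, one_mul, ← mul_pow] at hmono
  rw [hf.1.eq_mul_dslope, norm_mul, div_le_iff₀ (by positivity), mul_assoc]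
  refine le_mul_of_one_le_right (norm_nonneg z) ?_
  rwa [one_le_sq_iff₀ (by positivity)] at hmono

end OrderHalf

lemma le_norm_of_mem_closure_image_unitDisk {f : ℂ → ℂ} (hf : ContinuousOn f unitDisk)
    {ψ : ℝ → ℝ} (hψ : ContinuousAt ψ 1) (hle : ∀ z ∈ unitDisk, ψ ‖z‖ ≤ ‖f z‖) {y : ℂ}
    (hy : y ∈ closure (f '' unitDisk)) (hy' : y ∉ f '' unitDisk) : ψ 1 ≤ ‖y‖ := by
  obtain ⟨w, hw, hwy⟩ := mem_closure_iff_seq_limit.1 hy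
  choose z hz hzw using hw
  obtain ⟨a, ha, σ, hσ, hza⟩ := (isCompact_closedBall (0 : ℂ) 1).tendsto_subseq
    fun n => ball_subset_closedBall (hz n)
  have hfy : Tendsto (fun n => f (z (σ n))) atTop (𝓝 y) := by
    simpa only [hzw, Function.comp_def] using hwy.comp hσ.tendsto_atTop
  have ha1 : ‖a‖ = 1 := by
    refine (mem_closedBall_zero_iff.1 ha).antisymm (not_lt.1 fun ha' => hy' ⟨a, ?_, ?_⟩)
    · exact mem_unitDisk.2 ha'
    · have := hf.continuousAt (isOpen_unitDisk.mem_nhds (mem_unitDisk.2 ha'))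
      exact tendsto_nhds_unique (this.tendsto.comp hza) hfy
  have hlim : Tendsto (fun n => ψ ‖z (σ n)‖) atTop (𝓝 (ψ 1)) :=
    hψ.tendsto.comp (ha1 ▸ hza.norm)
  exact le_of_tendsto_of_tendsto' hlim hfy.norm fun n => hle _ (hz _)

section Image

variable {f : ℂ → ℂ} {U : Set ℂ}

lemma isOpen_image_of_deriv_ne_zero (hU : IsOpen U) (hf : DifferentiableOn ℂ f U)
    (hne : ∀ z ∈ U, deriv f z ≠ 0) : IsOpen (f '' U) := by
  rw [isOpen_iff_mem_nhds]
  rintro _ ⟨z, hz, rfl⟩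
  have hstrict := (hf.analyticAt (hU.mem_nhds hz)).hasStrictDerivAt
  rw [← hstrict.map_nhds_eq (hne z hz)]
  exact image_mem_map (hU.mem_nhds hz)

-- Otherwise the inverse would be a bounded entire function.
lemma image_ne_univ_of_isBounded (hU : IsOpen U) (hb : Bornology.IsBounded U)
    (hf : DifferentiableOn ℂ f U) (hinj : InjOn f U) (hne : ∀ z ∈ U, deriv f z ≠ 0) :
    f '' U ≠ univ := by
  intro hsurj
  have hright : ∀ w, ∃ z ∈ U, f z = w := eq_univ_iff_forall.1 hsurj
  choose g hgU hgf using hright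
  have hleft : ∀ z ∈ U, g (f z) = z := fun z hz => hinj (hgU _) hz (hgf _)
  have hdiff : Differentiable ℂ g := fun w => by
    have hstrict := (hf.analyticAt (hU.mem_nhds (hgU w))).hasStrictDerivAt
    have := hstrict.to_local_left_inverse (hne _ (hgU w))
      (eventually_of_mem (hU.mem_nhds (hgU w)) hleft)
    rw [hgf] at this
    exact this.hasDerivAt.differentiableAt
  have hconst := hdiff.apply_eq_apply_of_bounded
    (hb.subset (range_subset_iff.2 hgU)) 0 1
  exact zero_ne_one ((hgf 0).symm.trans (hconst ▸ hgf 1))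

end Image

lemma deriv_ne_zero_of_mem_starlikeOfOrder {f : ℂ → ℂ} {α : ℝ} (hα : 0 ≤ α)
    (hf : f ∈ starlikeOfOrder α) {z : ℂ} (hz : z ∈ unitDisk) : deriv f z ≠ 0 := by
  intro h
  have := hf.2 z hz
  rw [hf.1.starQuotient_eq hz, h, zero_div, zero_re] at this
  linarith

lemma half_le_infDist_frontier {f : ℂ → ℂ} (hf : f ∈ starlikeOfOrder (1 / 2)) :
    1 / 2 ≤ infDist (f 0) (frontier (f '' unitDisk)) := by
  have hne : ∀ z ∈ unitDisk, deriv f z ≠ 0 :=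
    fun z => deriv_ne_zero_of_mem_starlikeOfOrder (by norm_num) hf
  have hfrontier : (frontier (f '' unitDisk)).Nonempty := by
    rw [nonempty_iff_ne_empty, Ne, frontier_eq_empty_iff, not_or]
    exact ⟨(Nonempty.image f ⟨0, zero_mem_unitDisk⟩).ne_empty,
      image_ne_univ_of_isBounded isOpen_unitDisk isBounded_ball hf.1.analytic hf.1.injective hne⟩
  have hψ : ContinuousAt (fun r : ℝ => r / (1 + r)) 1 :=
    continuousAt_id.div (by fun_prop) (by norm_num)
  refine (le_infDist hfrontier).2 fun y hy => ?_
  rw [(isOpen_image_of_deriv_ne_zero isOpen_unitDisk hf.1.analytic hne).frontier_eq] at hy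
  rw [hf.1.map_zero, dist_zero_left, ← one_add_one_eq_two]
  exact le_norm_of_mem_closure_image_unitDisk hf.1.analytic.continuousOn hψ
    (fun z hz => div_one_add_norm_le_norm hf hz) hy.1 hy.2

lemma bohrInequality_of_mem_starlikeOfOrder {f : ℂ → ℂ} (hf : f ∈ starlikeOfOrder (1 / 2))
    {r : ℝ} (h0 : 0 ≤ r) (h1 : r ≤ 1 / 3) : BohrInequality f r := by
  have hle : ∀ n : ℕ, ‖taylorCoeff f (n + 2)‖ * r ^ (n + 2) ≤ r ^ 2 * r ^ n := fun n => by
    rw [← pow_add, add_comm 2 n]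
    exact mul_le_of_le_one_left (pow_nonneg h0 _) (norm_taylorCoeff_le_one hf _)
  have hgeom : HasSum (fun n : ℕ => r ^ 2 * r ^ n) (r ^ 2 * (1 - r)⁻¹) :=
    (hasSum_geometric_of_lt_one h0 (by linarith)).mul_left _
  have hsum : Summable fun n : ℕ => ‖taylorCoeff f (n + 2)‖ * r ^ (n + 2) :=
    hgeom.summable.of_nonneg_of_le (fun n => by positivity) hle
  refine ⟨hsum, ?_⟩
  calc _ ≤ r + r ^ 2 * (1 - r)⁻¹ := by
        gcongr
        exact hgeom.tsum_eq ▸ hsum.tsum_le_tsum hle hgeom.summable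
    _ = r / (1 - r) := by
        have : 1 - r ≠ 0 := by linarith
        field_simp
        ring
    _ ≤ 1 / 2 := by
        rw [div_le_iff₀ (by linarith)]
        linarith
    _ ≤ _ := half_le_infDist_frontier hf

/-! ### The class `S*_R` -/

/-- The number `√2 - 1`, reciprocal of the silver ratio `k = √2 + 1` in the definition of
`phiR`. -/
noncomputable def silverInv : ℝ := √2 - 1

lemma silverInv_sq_add : silverInv ^ 2 + 2 * silverInv = 1 := by
  linear_combination (norm := (unfold silverInv; ring)) Real.sq_sqrt (zero_le_two (α := ℝ))

lemma silverInv_pos : 0 < silverInv := sub_pos.2 Real.one_lt_sqrt_two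

lemma silverInv_lt_half : silverInv < 1 / 2 := by nlinarith [silverInv_sq_add, silverInv_pos]

lemma exp_silverInv_lt_two : Real.exp silverInv < 2 := by
  have h : Real.exp silverInv * (1 - silverInv) ≤ 1 := by
    calc _ ≤ Real.exp silverInv * Real.exp (-silverInv) := by
          gcongr
          exact Real.one_sub_le_exp_neg _
      _ = 1 := by rw [← Real.exp_add, add_neg_cancel, Real.exp_zero]
  nlinarith [silverInv_lt_half, Real.exp_pos silverInv]

lemma norm_silverInv_mul_lt {z : ℂ} (hz : z ∈ unitDisk) : ‖(silverInv : ℂ) * z‖ < silverInv := by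
  rw [norm_mul, norm_real, Real.norm_of_nonneg silverInv_pos.le]
  exact mul_lt_of_lt_one_right silverInv_pos (mem_unitDisk.1 hz)

lemma one_sub_silverInv_mul_ne_zero {z : ℂ} (hz : z ∈ unitDisk) :
    1 - (silverInv : ℂ) * z ≠ 0 := by
  intro h
  have := norm_silverInv_mul_lt hz
  rw [← sub_eq_zero.1 h, norm_one] at this
  linarith [silverInv_lt_half]

lemma phiR_eq (z : ℂ) :
    phiR z = 1 + silverInv * z * (1 + silverInv * z) / (1 - silverInv * z) := by
  have hs : (silverInv : ℂ) ≠ 0 := ofReal_ne_zero.2 silverInv_pos.ne'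
  have hk : ((√2 + 1 : ℝ) : ℂ) = (silverInv : ℂ)⁻¹ := by
    rw [← ofReal_inv, ofReal_inj]
    refine eq_inv_of_mul_eq_one_left ?_
    linear_combination (norm := (unfold silverInv; ring)) Real.sq_sqrt (zero_le_two (α := ℝ))
  have hdiv : ((silverInv : ℂ)⁻¹ + z) / ((silverInv : ℂ)⁻¹ - z) =
      (1 + silverInv * z) / (1 - silverInv * z) := by
    rw [← mul_div_mul_left _ _ hs, mul_add, mul_sub, mul_inv_cancel₀ hs]
  rw [phiR, hk, hdiv, div_inv_eq_mul]
  ring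

lemma half_lt_re_phiR {z : ℂ} (hz : z ∈ unitDisk) : 1 / 2 < (phiR z).re := by
  set x : ℂ := silverInv * z with hx
  have hne : 1 - x ≠ 0 := one_sub_silverInv_mul_ne_zero hz
  have hpos : 0 < normSq (1 - x) := normSq_pos.2 hne
  have hphi : phiR z = 2 * (1 - x)⁻¹ - (1 + x) := by
    rw [phiR_eq, ← hx]
    field_simp
    ring
  have hre : (phiR z).re = 2 * (1 - x.re) / normSq (1 - x) - (1 + x.re) := by
    simp [hphi, mul_div_assoc]
  have hnorm : normSq (1 - x) ≤ 2 * (1 - x.re - silverInv) := by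
    have hsq : normSq x ≤ silverInv ^ 2 := by
      rw [normSq_eq_norm_sq]
      have := (norm_silverInv_mul_lt hz).le
      gcongr
    rw [normSq_apply] at hsq ⊢
    simp only [sub_re, one_re, sub_im, one_im]
    linarith [silverInv_sq_add]
  have hxre : |x.re| ≤ silverInv := (abs_re_le_norm x).trans (norm_silverInv_mul_lt hz).le
  rw [hre, lt_sub_iff_add_lt, lt_div_iff₀ hpos]
  calc (1 / 2 + (1 + x.re)) * normSq (1 - x)
      ≤ (1 / 2 + (1 + x.re)) * (2 * (1 - x.re - silverInv)) := by
        gcongr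
        linarith [(abs_le.1 hxre).1, silverInv_lt_half]
    _ < 2 * (1 - x.re) := by
        nlinarith [silverInv_sq_add, mul_pos silverInv_pos (sub_pos.2 silverInv_lt_half),
          sq_nonneg (2 * x.re + silverInv - 1 / 2)]

lemma starlikeClassR_subset : starlikeClassR ⊆ starlikeOfOrder (1 / 2) := by
  rintro f ⟨hu, ω, -, hmaps, -, hω⟩
  refine ⟨hu, fun z hz => ?_⟩
  rw [hω z hz]
  exact half_lt_re_phiR (hmaps hz)

/-! ### The extremal function -/

-- For fixed `u` and `v`, the function `t ↦ u * G (t * v) - v * G (t * u)` starts at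
-- `(u - v) * G 0`, ends at `0` when the two values agree, and varies by at most `C * ‖u - v‖`.
lemma injOn_div_of_norm_deriv_deriv_le {G : ℂ → ℂ} {C : ℝ} (hG : DifferentiableOn ℂ G unitDisk)
    (hne : ∀ z ∈ unitDisk, G z ≠ 0) (hC : ∀ z ∈ unitDisk, ‖deriv (deriv G) z‖ ≤ C)
    (hlt : C < ‖G 0‖) : InjOn (fun z => z / G z) unitDisk := by
  intro u hu v hv huv
  simp only [div_eq_div_iff (hne u hu) (hne v hv)] at huv
  have hG_at : ∀ t ∈ Icc (0 : ℝ) 1, ∀ w ∈ unitDisk, DifferentiableAt ℂ G (t * w) :=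
    fun t ht w hw => hG.differentiableAt (isOpen_unitDisk.mem_nhds (real_mul_mem_unitDisk ht hw))
  have hderiv : ∀ t ∈ Icc (0 : ℝ) 1, HasDerivWithinAt (fun t : ℝ => u * G (t * v) - v * G (t * u))
      (u * (deriv G (t * v) * v) - v * (deriv G (t * u) * u)) (Icc 0 1) t := fun t ht =>
    (((hasDerivAt_comp_ofReal_mul (hG_at t ht v hv)).const_mul u).sub
      ((hasDerivAt_comp_ofReal_mul (hG_at t ht u hu)).const_mul v)).hasDerivWithinAt
  have hC0 : 0 ≤ C := (norm_nonneg _).trans (hC 0 zero_mem_unitDisk)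
  have hbound : ∀ t ∈ Ico (0 : ℝ) 1,
      ‖u * (deriv G (t * v) * v) - v * (deriv G (t * u) * u)‖ ≤ C * ‖v - u‖ := by
    intro t ht
    have ht' := Ico_subset_Icc_self ht
    have hmvt : ‖deriv G (t * v) - deriv G (t * u)‖ ≤ C * ‖t * v - t * u‖ :=
      (convex_ball (0 : ℂ) 1).norm_image_sub_le_of_norm_deriv_le
        (fun z hz => (hG.deriv isOpen_unitDisk).differentiableAt (isOpen_unitDisk.mem_nhds hz)) hC
        (real_mul_mem_unitDisk ht' hu) (real_mul_mem_unitDisk ht' hv)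
    rw [← mul_sub, norm_mul, norm_real, Real.norm_of_nonneg ht.1] at hmvt
    calc _ = ‖u‖ * ‖v‖ * ‖deriv G (t * v) - deriv G (t * u)‖ := by
          rw [← norm_mul, ← norm_mul]
          congr 1
          ring
      _ ≤ 1 * 1 * (C * (1 * ‖v - u‖)) := by
          gcongr
          · exact (mem_unitDisk.1 hu).le
          · exact (mem_unitDisk.1 hv).le
          · exact hmvt.trans (by gcongr; exact ht.2.le)
      _ = C * ‖v - u‖ := by ring
  have hle := norm_image_sub_le_of_norm_deriv_le_segment_01' hderiv hbound
  simp only [ofReal_one, one_mul, ofReal_zero, zero_mul, huv, sub_self, zero_sub, norm_neg,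
    ← sub_mul, norm_mul, norm_sub_rev u v, mul_comm _ ‖G 0‖] at hle
  by_contra hne_uv
  exact hle.not_gt (mul_lt_mul_of_pos_right hlt (norm_pos_iff.2 (sub_ne_zero.2 (Ne.symm hne_uv))))

/-- The entire function by which `z` has to be divided to obtain the extremal function of the
class `S*_R`. -/
noncomputable def extremalDenom (z : ℂ) : ℂ :=
  Complex.exp (silverInv * z) * (1 - silverInv * z) ^ 2

lemma extremalDenom_zero : extremalDenom 0 = 1 := by simp [extremalDenom]

lemma extremalDenom_ne_zero {z : ℂ} (hz : z ∈ unitDisk) : extremalDenom z ≠ 0 :=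
  mul_ne_zero (Complex.exp_ne_zero _) (pow_ne_zero _ (one_sub_silverInv_mul_ne_zero hz))

lemma hasDerivAt_extremalDenom (z : ℂ) : HasDerivAt extremalDenom
    (-silverInv * (Complex.exp (silverInv * z) * (1 - (silverInv * z) ^ 2))) z := by
  have hlin : HasDerivAt (fun w : ℂ => (silverInv : ℂ) * w) silverInv z := by
    simpa using (hasDerivAt_id z).const_mul (silverInv : ℂ)
  refine (hlin.cexp.mul ((hlin.const_sub 1).pow 2)).congr_deriv ?_
  simp only [Nat.cast_ofNat, Pi.pow_apply]
  ring

lemma deriv_deriv_extremalDenom (z : ℂ) : deriv (deriv extremalDenom) z =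
    -silverInv ^ 2 * (Complex.exp (silverInv * z) *
      (1 - 2 * (silverInv * z) - (silverInv * z) ^ 2)) := by
  have hlin : HasDerivAt (fun w : ℂ => (silverInv : ℂ) * w) silverInv z := by
    simpa using (hasDerivAt_id z).const_mul (silverInv : ℂ)
  rw [funext fun w => (hasDerivAt_extremalDenom w).deriv]
  refine ((hlin.cexp.mul ((hlin.pow 2).const_sub 1)).const_mul (-silverInv : ℂ)).deriv.trans ?_
  simp only [Nat.cast_ofNat, Pi.pow_apply]
  ring

lemma norm_deriv_deriv_extremalDenom_le {z : ℂ} (hz : z ∈ unitDisk) :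
    ‖deriv (deriv extremalDenom) z‖ ≤ silverInv ^ 2 * (2 * 2) := by
  have hx := (norm_silverInv_mul_lt hz).le
  rw [deriv_deriv_extremalDenom, norm_mul, norm_neg, norm_pow, norm_real,
    Real.norm_of_nonneg silverInv_pos.le, norm_mul]
  gcongr
  · calc ‖Complex.exp (silverInv * z)‖ ≤ Real.exp ‖silverInv * z‖ := norm_exp_le_exp_norm _
      _ ≤ Real.exp silverInv := by gcongr
      _ ≤ 2 := exp_silverInv_lt_two.le
  · calc ‖1 - 2 * (silverInv * z) - (silverInv * z) ^ 2‖
        ≤ 1 + 2 * ‖silverInv * z‖ + ‖silverInv * z‖ ^ 2 := by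
          refine (norm_sub_le _ _).trans ?_
          rw [norm_pow]
          gcongr
          refine (norm_sub_le _ _).trans_eq ?_
          rw [norm_one, norm_mul, RCLike.norm_ofNat]
      _ ≤ 1 + 2 * silverInv + silverInv ^ 2 := by gcongr
      _ = 2 := by linear_combination silverInv_sq_add

lemma mul_deriv_extremalDenom {z : ℂ} (hz : z ∈ unitDisk) :
    z * deriv extremalDenom z = extremalDenom z * (1 - phiR z) := by
  have := one_sub_silverInv_mul_ne_zero hz
  rw [mul_comm] at this
  rw [(hasDerivAt_extremalDenom z).deriv, phiR_eq, extremalDenom]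
  field_simp
  ring

/-- The function `z exp (-z / k) / (1 - z / k) ^ 2` with `k = √2 + 1`, which is extremal in the
class `S*_R`. -/
noncomputable def extremal (z : ℂ) : ℂ := z / extremalDenom z

lemma hasDerivAt_extremal {z : ℂ} (hz : z ∈ unitDisk) :
    HasDerivAt extremal (phiR z / extremalDenom z) z := by
  have hne := extremalDenom_ne_zero hz
  refine ((hasDerivAt_id z).div (hasDerivAt_extremalDenom z).differentiableAt.hasDerivAt
    hne).congr_deriv ?_
  rw [id, mul_deriv_extremalDenom hz]
  field_simp
  ring

lemma injOn_extremal : InjOn extremal unitDisk := by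
  refine injOn_div_of_norm_deriv_deriv_le
    (fun z _ => (hasDerivAt_extremalDenom z).differentiableAt.differentiableWithinAt)
    (fun z => extremalDenom_ne_zero) (fun z => norm_deriv_deriv_extremalDenom_le) ?_
  rw [extremalDenom_zero, norm_one]
  nlinarith [silverInv_pos, silverInv_lt_half]

lemma isKoebeOf_extremal : IsKoebeOf phiR extremal := by
  refine ⟨⟨fun z hz => (hasDerivAt_extremal hz).differentiableAt.differentiableWithinAt,
    injOn_extremal, zero_div _, ?_⟩, fun z hz => ?_⟩
  · rw [(hasDerivAt_extremal zero_mem_unitDisk).deriv, extremalDenom_zero]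
    simp [phiR]
  · rw [starQuotient]
    split_ifs with h0
    · simp [h0, phiR]
    · have := extremalDenom_ne_zero hz
      rw [(hasDerivAt_extremal hz).deriv, extremal]
      field_simp

lemma IsKoebeOf.eqOn {φ g h : ℂ → ℂ} (hg : IsKoebeOf φ g) (hh : IsKoebeOf φ h) :
    EqOn g h unitDisk :=
  hg.1.eqOn_of_starQuotient_eqOn hh.1 fun z hz => (hg.2 z hz).trans (hh.2 z hz).symm

/-! ### The smallest root -/

/-- The restriction of `extremal` to the real axis. -/
noncomputable def extremalReal (r : ℝ) : ℝ :=
  r / (Real.exp (silverInv * r) * (1 - silverInv * r) ^ 2)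

lemma extremal_ofReal (r : ℝ) : extremal r = extremalReal r := by
  simp [extremal, extremalReal, extremalDenom]

lemma one_sub_silverInv_mul_pos {r : ℝ} (hr : r ≤ 1) : 0 < 1 - silverInv * r := by
  nlinarith [silverInv_pos, silverInv_lt_half]

lemma continuousOn_extremalReal : ContinuousOn extremalReal (Iic 1) := by
  refine continuousOn_id.div (by fun_prop) fun r hr => ?_
  have := one_sub_silverInv_mul_pos hr
  positivity

lemma extremalReal_neg_one : extremalReal (-1) = -(Real.exp silverInv / 2) := by
  have hsq : (1 - silverInv * -1) ^ 2 = 2 := by linear_combination silverInv_sq_add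
  rw [extremalReal, hsq, mul_neg_one, Real.exp_neg]
  field_simp

lemma neg_extremalReal_neg_one_lt : -extremalReal (-1) < extremalReal 1 := by
  have hsq : (1 - silverInv * 1) ^ 2 = 2 * silverInv ^ 2 := by
    linear_combination -silverInv_sq_add
  have hlt : silverInv * Real.exp silverInv < 1 := by
    nlinarith [silverInv_lt_half, exp_silverInv_lt_two, silverInv_pos]
  have hpos := silverInv_pos
  rw [extremalReal_neg_one, neg_neg, extremalReal, hsq, mul_one, lt_div_iff₀ (by positivity)]
  calc _ = (silverInv * Real.exp silverInv) ^ 2 := by ring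
    _ < 1 := pow_lt_one₀ (by positivity) hlt two_ne_zero

lemma extremalReal_lt_neg_extremalReal_neg_one {r : ℝ} (h0 : 0 < r) (h1 : r ≤ 1 / 3) :
    extremalReal r < -extremalReal (-1) := by
  have hpos := one_sub_silverInv_mul_pos (h1.trans (by norm_num))
  have hsq : 2 * r < (1 - silverInv * r) ^ 2 := by
    nlinarith [silverInv_lt_half, sq_nonneg (silverInv * r)]
  have hexp : 1 ≤ Real.exp (silverInv * r) := Real.one_le_exp (mul_pos silverInv_pos h0).le
  calc extremalReal r < 1 / 2 := by
        rw [extremalReal, div_lt_iff₀ (by positivity)]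
        nlinarith
    _ ≤ -extremalReal (-1) := by
        rw [extremalReal_neg_one, neg_neg]
        gcongr
        exact Real.one_le_exp silverInv_pos.le

lemma exists_isLeast_eq_of_lt_of_lt {F : ℝ → ℝ} {a b c : ℝ} (hab : a ≤ b)
    (hF : ContinuousOn F (Icc a b)) (ha : F a < c) (hb : c < F b) :
    ∃ r ∈ Ioo a b, IsLeast (Icc a b ∩ F ⁻¹' {c}) r := by
  have hcompact : IsCompact (Icc a b ∩ F ⁻¹' {c}) :=
    isCompact_Icc.of_isClosed_subset
      (hF.preimage_isClosed_of_isClosed isClosed_Icc isClosed_singleton) inter_subset_left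
  obtain ⟨r, hr⟩ := hcompact.exists_isLeast (intermediate_value_Icc hab hF ⟨ha.le, hb.le⟩)
  have hrc : F r = c := hr.1.2
  refine ⟨r, ⟨hr.1.1.1.lt_of_ne ?_, hr.1.1.2.lt_of_ne ?_⟩, hr⟩
  · rintro rfl
    exact ha.ne hrc
  · rintro rfl
    exact hb.ne' hrc

lemma exists_isLeast_extremalReal : ∃ rf : ℝ, 1 / 3 < rf ∧
    IsLeast {r : ℝ | 0 < r ∧ r < 1 ∧ extremalReal r + extremalReal (-1) = 0} rf := by
  obtain ⟨rf, hrf, ⟨-, hroot⟩, hmin⟩ := exists_isLeast_eq_of_lt_of_lt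
    (show (1 / 3 : ℝ) ≤ 1 by norm_num) (continuousOn_extremalReal.mono fun r hr => hr.2)
    (extremalReal_lt_neg_extremalReal_neg_one (by norm_num) le_rfl) neg_extremalReal_neg_one_lt
  refine ⟨rf, hrf.1, ⟨(by norm_num : (0 : ℝ) < 1 / 3).trans hrf.1, hrf.2,
    add_eq_zero_iff_eq_neg.2 hroot⟩, ?_⟩
  rintro r ⟨hr0, hr1, hr⟩
  rw [add_eq_zero_iff_eq_neg] at hr
  refine hmin ⟨⟨?_, hr1.le⟩, hr⟩
  by_contra! hlt
  exact (extremalReal_lt_neg_extremalReal_neg_one hr0 hlt.le).ne hr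

lemma IsKoebeOf.apply_ofReal {h : ℂ → ℂ} (hh : IsKoebeOf phiR h) {r : ℝ} (hr : |r| < 1) :
    h r = extremalReal r := by
  rw [hh.eqOn isKoebeOf_extremal (by rwa [mem_unitDisk, norm_real]), extremal_ofReal]

lemma IsKoebeOf.tendsto_neg {h : ℂ → ℂ} (hh : IsKoebeOf phiR h) :
    Tendsto (fun r : ℝ => h (-(r : ℂ))) (𝓝[<] 1) (𝓝 (extremalReal (-1))) := by
  have hcont : ContinuousAt extremalReal (-1) :=
    continuousOn_extremalReal.continuousAt (Iic_mem_nhds (by norm_num))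
  have hlim : Tendsto (fun r : ℝ => (extremalReal (-r) : ℂ)) (𝓝[<] 1) (𝓝 (extremalReal (-1))) :=
    ((continuous_ofReal.tendsto _).comp (hcont.tendsto.comp (continuous_neg.tendsto 1))).mono_left
      nhdsWithin_le_nhds
  refine hlim.congr' ?_
  filter_upwards [Ioo_mem_nhdsLT (zero_lt_one (α := ℝ))] with r hr
  rw [← ofReal_neg, hh.apply_ofReal (by rw [abs_neg, abs_of_pos hr.1]; exact hr.2)]

lemma IsKoebeOf.exists_isSmallestRoot {h : ℂ → ℂ} (hh : IsKoebeOf phiR h) :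
    ∃ rf : ℝ, IsSmallestRoot h rf ∧ 1 / 3 < rf := by
  obtain ⟨rf, hrf, hleast⟩ := exists_isLeast_extremalReal
  refine ⟨rf, ⟨extremalReal (-1), hh.tendsto_neg, ?_⟩, hrf⟩
  convert hleast using 1
  ext r
  refine and_congr_right fun h0 => and_congr_right fun h1 => ?_
  rw [hh.apply_ofReal (by rwa [abs_of_pos h0]), ← ofReal_add, ofReal_eq_zero]

end Bohr

theorem corollary2p6_general :
    (∀ f ∈ Bohr.starlikeOfOrder (1 / 2), ∀ z : ℂ, ‖z‖ ≤ 1 / 3 → Bohr.BohrInequality f ‖z‖) ∧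
    (∃ h : ℂ → ℂ, Bohr.IsKoebeOf Bohr.phiR h) ∧
    (∀ h : ℂ → ℂ, Bohr.IsKoebeOf Bohr.phiR h →
      ∃ rf : ℝ, Bohr.IsSmallestRoot h rf ∧ 1 / 3 < rf) :=
  ⟨fun _ hf _ hz => Bohr.bohrInequality_of_mem_starlikeOfOrder hf (norm_nonneg _) hz,
    ⟨Bohr.extremal, Bohr.isKoebeOf_extremal⟩, fun _ hh => hh.exists_isSmallestRoot⟩

theorem corollary2p6 :
    (∀ f ∈ Bohr.starlikeClassR, ∀ z : ℂ, ‖z‖ ≤ 1 / 3 → Bohr.BohrInequality f ‖z‖) ∧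
    (∃ h : ℂ → ℂ, Bohr.IsKoebeOf Bohr.phiR h) ∧
    (∀ h : ℂ → ℂ, Bohr.IsKoebeOf Bohr.phiR h →
      ∃ rf : ℝ, Bohr.IsSmallestRoot h rf ∧ 1 / 3 < rf) :=
  ⟨fun f hf => corollary2p6_general.1 f (Bohr.starlikeClassR_subset hf), corollary2p6_general.2⟩
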